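/- Let $K\ge 2$ and let $\lambda=(\lambda_1,\dots,\lambda_d)$ be a probability vector whose non-zero entries are not exactly $K$ copies of $1/K$. Write $$\rho_\lambda=\sum_{i,j=1}^d\sqrt{\lambda_i\lambda_j}\,|ii\rangle\langle jj|$$ for the bipartite pure state with Schmidt coefficient vector $\lambda$, and let $\Phi_C$ be the maximally entangled state of rank $C$, i.e. $\rho_\mu$ for $\mu=(1/C,\dots,1/C)\in\mathbb{R}^C$. (The condition on $\lambda$ says that $\rho_\lambda$ is not $\Phi_K$, up to local isometries.) A PPT operation is a completely positive trace-preserving linear map $\mathcal{L}$ between operators on bipartite systems such that $\Gamma\circ\mathcal{L}\circ\Gamma$ is also completely positive, where $\Gamma$ is the partial transpose, $(|ij\rangle\langle kl|)^\Gamma=|il\rangle\langle kj|$. Let $S_{1/2}(\lambda)=2\log_2\sum_{i}\sqrt{\lambda_i}$ be the Rényi entropy at $1/2$. Then there is an integer $C\ge 2$ and a PPT operation $\mathcal{L}$ with $\mathcal{L}(\Phi_C\otimes\Phi_K)=\Phi_C\otimes\rho_\lambda$ if and only if $S_{1/2}(\lambda)<\log_2 K$. Moreover, if $S_{1/2}(\lambda)<\log_2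 K$, then such a PPT operation exists for all sufficiently large $C$. (In the tensor products each party holds its share of both factors.) -/

import Mathlib

open scoped Kronecker ComplexOrder

namespace PPTCatalysis

section Maps

variable {m n : Type*}

/-- The ampliation `id_k ⊗ L` of a linear map `L` between matrix algebras: a matrix on
`ℂ^k ⊗ ℂ^m` is seen as a `k × k` block matrix and `L` is applied to every block. -/
def ampliation (k : ℕ) (L : Matrix m m ℂ →ₗ[ℂ] Matrix n n ℂ)
    (X : Matrix (Fin k × m) (Fin k × m) ℂ) : Matrix (Fin k × n) (Fin k × n) ℂ :=
  Matrix.of fun p q => L (Matrix.of fun r s => X (p.1, r) (q.1, s)) p.2 q.2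

/-- `L` is completely positive: every ampliation `id_k ⊗ L` maps positive semidefinite
matrices to positive semidefinite matrices. -/
def IsCompletelyPositive (L : Matrix m m ℂ →ₗ[ℂ] Matrix n n ℂ) : Prop :=
  ∀ (k : ℕ) (X : Matrix (Fin k × m) (Fin k × m) ℂ),
    X.PosSemidef → (ampliation k L X).PosSemidef

/-- `L` preserves the trace. -/
def IsTracePreserving [Fintype m] [Fintype n]
    (L : Matrix m m ℂ →ₗ[ℂ] Matrix n n ℂ) : Prop :=
  ∀ X : Matrix m m ℂ, (L X).trace = X.trace

end Maps

section Bipartite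

variable {a b a' b' : Type*}

/-- Operators on the bipartite space `ℂ^a ⊗ ℂ^b`, in the product basis `|i j⟩`. -/
abbrev BipartiteOp (a b : Type*) := Matrix (a × b) (a × b) ℂ

/-- The partial transpose, the linear map with `(|i j⟩⟨k l|)^Γ = |i l⟩⟨k j|`. -/
def partialTranspose (a b : Type*) : BipartiteOp a b →ₗ[ℂ] BipartiteOp a b where
  toFun X := Matrix.of fun p q => X (p.1, q.2) (q.1, p.2)
  map_add' _ _ := rfl
  map_smul' _ _ := rfl

/-- A PPT operation: a completely positive trace preserving map `L` from operators on
`ℂ^a ⊗ ℂ^b` to operators on `ℂ^a' ⊗ ℂ^b'` such that `Γ ∘ L ∘ Γ` is completely positive. -/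
structure IsPPTOperation [Fintype a] [Fintype b] [Fintype a'] [Fintype b']
    (L : BipartiteOp a b →ₗ[ℂ] BipartiteOp a' b') : Prop where
  completelyPositive : IsCompletelyPositive L
  tracePreserving : IsTracePreserving L
  completelyPositive_partialTranspose :
    IsCompletelyPositive (partialTranspose a' b' ∘ₗ L ∘ₗ partialTranspose a b)

/-- The state `ρ` can be transformed (deterministically) into `σ` by a PPT operation. -/
def PPTTransforms [Fintype a] [Fintype b] [Fintype a'] [Fintype b']
    (ρ : BipartiteOp a b) (σ : BipartiteOp a' b') : Prop :=
  ∃ L : BipartiteOp a b →ₗ[ℂ] BipartiteOp a' b', IsPPTOperation L ∧ L ρ = σ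

/-- The tensor product of two bipartite operators, seen as an operator on a bipartite system
in which one party holds both first factors and the other party holds both second factors. -/
def bipartiteTensor (ρ : BipartiteOp a b) (σ : BipartiteOp a' b') :
    BipartiteOp (a × a') (b × b') :=
  (ρ ⊗ₖ σ).submatrix (Equiv.prodProdProdComm a a' b b') (Equiv.prodProdProdComm a a' b b')

end Bipartite

/-- The pure state `∑ i j, √(lam i * lam j) |i i⟩⟨j j|` with Schmidt coefficients `lam`. -/
noncomputable def schmidtState {d : ℕ} (lam : Fin d → ℝ) : BipartiteOp (Fin d) (Fin d) :=
  Matrix.of fun p q =>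
    if p.1 = p.2 ∧ q.1 = q.2 then ((Real.sqrt (lam p.1 * lam q.1) : ℝ) : ℂ) else 0

/-- The uniform probability vector with `K` entries. -/
noncomputable def uniformVec (K : ℕ) : Fin K → ℝ := fun _ => 1 / (K : ℝ)

/-- The maximally entangled state `Φ_K` of rank `K`. -/
noncomputable def maxEntangled (K : ℕ) : BipartiteOp (Fin K) (Fin K) :=
  schmidtState (uniformVec K)

open Classical in
/-- The multiset of nonzero entries of a Schmidt coefficient vector. It determines the state
up to local isometries. -/
noncomputable def schmidtCoeffs {d : ℕ} (lam : Fin d → ℝ) : Multiset ℝ :=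
  (Finset.univ.val.map lam).filter (fun x => x ≠ 0)

/-- The Rényi entropy at `t`, for `t ∈ (0,1) ∪ (1,∞)`, with logarithm to base two. -/
noncomputable def renyiEntropy {d : ℕ} (t : ℝ) (lam : Fin d → ℝ) : ℝ :=
  1 / (1 - t) * Real.logb 2 (∑ i, lam i ^ t)

end PPTCatalysis

/-! Put `T = (∑ √λᵢ)²`, so that `S_{1/2}(λ) < log₂ K` reads `T < K`. Both states are pure with
explicit Schmidt vectors: the source is maximally entangled of rank `N = CK`, and the target has
squared amplitude sum `CT`. For a pure target with amplitudes `a`, conversion from `Φ_N` is possible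
if `(∑ aᵢ)² ≤ N - 1` (`pptTransforms_of_sq_sum_le`) and forces `(∑ aᵢ)² ≤ N`
(`sq_sum_le_of_pptTransforms`). The catalyst multiplies both sides by `C` but not the gap of `1`: if
`T < K`, then `CT ≤ CK - 1` as soon as `C ≥ 1/(K - T)`. Conversely a conversion gives `T ≤ K`. If `T
= K`, the Schmidt rank of the target is at most `N`, and equality in Cauchy-Schwarz makes its
amplitudes uniform on their support; then `λ` consists of `K` copies of `1/K` and zeros, which is
excluded. -/

namespace PPTCatalysis

/-! ### Measure-and-prepare maps, complete positivity and the partial transpose. -/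

section General

variable {ι κ m n : Type*}

/-- The map `X ↦ tr (E X) R`, which measures the effect `E` and prepares `R`. -/
def measurePrepare [Fintype m] (E : Matrix m m ℂ) (R : Matrix n n ℂ) :
    Matrix m m ℂ →ₗ[ℂ] Matrix n n ℂ where
  toFun X := (E * X).trace • R
  map_add' X Y := by rw [mul_add, Matrix.trace_add, add_smul]
  map_smul' c X := by simp [mul_smul]

lemma measurePrepare_apply [Fintype m] (E : Matrix m m ℂ) (R : Matrix n n ℂ)
    (X : Matrix m m ℂ) : measurePrepare E R X = (E * X).trace • R := rfl

-- Writing `E = G* G` turns the blockwise trace into a sum of congruences of `X`, one for each row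
-- of `G`.
open scoped MatrixOrder in
lemma posSemidef_blockTrace [Fintype m] [DecidableEq m] {E : Matrix m m ℂ}
    (hE : E.PosSemidef) {k : ℕ}
    {X : Matrix (Fin k × m) (Fin k × m) ℂ} (hX : X.PosSemidef) :
    (Matrix.of fun i j : Fin k =>
      (E * Matrix.of fun r s => X (i, r) (j, s)).trace).PosSemidef := by
  obtain ⟨G, rfl⟩ := CStarAlgebra.nonneg_iff_eq_star_mul_self.mp hE.nonneg
  let B : m → Matrix (Fin k × m) (Fin k) ℂ := fun c =>
    Matrix.of fun p l => if p.1 = l then star (G c p.2) else 0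
  have key : (Matrix.of fun i j : Fin k =>
      ((star G * G) * Matrix.of fun r s => X (i, r) (j, s)).trace) =
      ∑ c, (B c).conjTranspose * X * B c := by
    ext i j
    rw [Matrix.sum_apply, Matrix.star_eq_conjTranspose]
    simp only [Matrix.of_apply, Matrix.trace, Matrix.diag_apply, Matrix.mul_apply,
      Matrix.conjTranspose_apply, B, Fintype.sum_prod_type, apply_ite star, star_star, star_zero,
      ite_mul, mul_ite, zero_mul, mul_zero, Finset.sum_ite_irrel, Finset.sum_const_zero,
      Finset.sum_ite_eq', Finset.mem_univ, if_true]
    simp only [Finset.sum_mul]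
    calc _ = ∑ x, ∑ c, ∑ y, star (G c x) * G c y * X (i, y) (j, x) :=
          Finset.sum_congr rfl fun x _ => Finset.sum_comm
      _ = ∑ c, ∑ x, ∑ y, star (G c x) * G c y * X (i, y) (j, x) := Finset.sum_comm
      _ = _ := by
          refine Finset.sum_congr rfl fun c _ => Finset.sum_congr rfl fun x _ =>
            Finset.sum_congr rfl fun y _ => by ring
  rw [key]
  exact Matrix.posSemidef_sum _ fun c _ => hX.conjTranspose_mul_mul_same (B c)

lemma isCompletelyPositive_measurePrepare [Fintype m] [Finite n]
    {E : Matrix m m ℂ} {R : Matrix n n ℂ} (hE : E.PosSemidef) (hR : R.PosSemidef) :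
    IsCompletelyPositive (measurePrepare E R) := by
  classical
  have := Fintype.ofFinite n
  intro k X hX
  exact (posSemidef_blockTrace hE hX).kronecker hR

lemma IsCompletelyPositive.add {L M : Matrix m m ℂ →ₗ[ℂ] Matrix n n ℂ}
    (hL : IsCompletelyPositive L) (hM : IsCompletelyPositive M) :
    IsCompletelyPositive (L + M) :=
  fun k X hX => (hL k X hX).add (hM k X hX)

lemma IsCompletelyPositive.posSemidef_map {L : Matrix m m ℂ →ₗ[ℂ] Matrix n n ℂ}
    (hL : IsCompletelyPositive L) {X : Matrix m m ℂ} (hX : X.PosSemidef) :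
    (L X).PosSemidef :=
  (hL 1 (X.submatrix Prod.snd Prod.snd) (hX.submatrix _)).submatrix fun p => ((0 : Fin 1), p)

lemma partialTranspose_apply (X : BipartiteOp ι κ) (p q : ι × κ) :
    partialTranspose ι κ X p q = X (p.1, q.2) (q.1, p.2) := rfl

lemma trace_mul_partialTranspose [Fintype ι] [Fintype κ] (E X : BipartiteOp ι κ) :
    (E * partialTranspose ι κ X).trace = (partialTranspose ι κ E * X).trace := by
  simp only [Matrix.trace, Matrix.diag_apply, Matrix.mul_apply, Fintype.sum_prod_type,
    partialTranspose_apply]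
  refine Finset.sum_congr rfl fun i _ => ?_
  calc _ = ∑ k, ∑ j, ∑ l, E (i, j) (k, l) * X (k, j) (i, l) := Finset.sum_comm
    _ = ∑ k, ∑ l, ∑ j, E (i, j) (k, l) * X (k, j) (i, l) :=
        Finset.sum_congr rfl fun k _ => Finset.sum_comm
    _ = _ := Finset.sum_comm

lemma partialTranspose_partialTranspose (X : BipartiteOp ι κ) :
    partialTranspose ι κ (partialTranspose ι κ X) = X := rfl

lemma partialTranspose_diagonal [DecidableEq ι] [DecidableEq κ] (w : ι × κ → ℂ) :
    partialTranspose ι κ (Matrix.diagonal w) = Matrix.diagonal w := by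
  ext ⟨i, j⟩ ⟨k, l⟩
  simp only [partialTranspose_apply, Matrix.diagonal_apply, Prod.mk.injEq]
  by_cases h : i = k
  · by_cases h' : j = l
    · simp [h, h']
    · simp [h', Ne.symm h']
  · simp [h]

lemma partialTranspose_comp_measurePrepare [Fintype ι] [Fintype κ] (E : BipartiteOp ι ι)
    (R : BipartiteOp κ κ) :
    partialTranspose κ κ ∘ₗ measurePrepare E R ∘ₗ partialTranspose ι ι =
      measurePrepare (partialTranspose ι ι E) (partialTranspose κ κ R) := by
  ext1 X
  simp only [LinearMap.comp_apply, measurePrepare_apply, map_smul, trace_mul_partialTranspose]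

lemma sum_const_sq [Fintype ι] {N : ℝ} (hN : (Fintype.card ι : ℝ) = N) (hpos : 0 < N) :
    ∑ _i : ι, (1 / √N) ^ 2 = 1 := by
  rw [Finset.sum_const, Finset.card_univ, nsmul_eq_mul, hN, div_pow, Real.sq_sqrt hpos.le]
  field_simp

/-! ### The flip operator and the partial transpose of a pure state. -/

/-- The flip operator `|i j⟩ ↦ |j i⟩`. -/
def flipOp (ι : Type*) [DecidableEq ι] : BipartiteOp ι ι :=
  (1 : BipartiteOp ι ι).submatrix id Prod.swap

/-- The operator `|v⟩⟨v|` for the vector `v = ∑ i, a i |i i⟩`. -/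
def schmidtPure [DecidableEq ι] (a : ι → ℝ) : BipartiteOp ι ι :=
  Matrix.of fun p q => if p.1 = p.2 ∧ q.1 = q.2 then ((a p.1 * a q.1 : ℝ) : ℂ) else 0

/-- The diagonal operator with entries `a i * a j`. -/
def weightOp [DecidableEq ι] (a : ι → ℝ) : BipartiteOp ι ι :=
  Matrix.diagonal fun p => ((a p.1 * a p.2 : ℝ) : ℂ)

variable [DecidableEq ι]

lemma partialTranspose_one : partialTranspose ι ι 1 = 1 := by
  rw [← Matrix.diagonal_one, partialTranspose_diagonal]

lemma partialTranspose_weightOp (a : ι → ℝ) :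
    partialTranspose ι ι (weightOp a) = weightOp a :=
  partialTranspose_diagonal _

lemma flipOp_apply (p q : ι × ι) : flipOp ι p q = if p = q.swap then 1 else 0 := by
  simp [flipOp, Matrix.one_apply]

lemma conjTranspose_flipOp : (flipOp ι).conjTranspose = flipOp ι := by
  ext p q
  simp only [Matrix.conjTranspose_apply, flipOp_apply, apply_ite star, star_one, star_zero]
  congr 1
  exact propext ⟨fun h => by simp [h], fun h => by simp [h]⟩

lemma schmidtPure_eq_vecMulVec (a : ι → ℝ) :
    schmidtPure a = Matrix.vecMulVec (fun p : ι × ι => if p.1 = p.2 then (a p.1 : ℂ) else 0)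
      (star fun p : ι × ι => if p.1 = p.2 then (a p.1 : ℂ) else 0) := by
  ext p q
  by_cases h : p.1 = p.2 <;> by_cases h' : q.1 = q.2 <;>
    simp [schmidtPure, Matrix.vecMulVec_apply, h, h']

lemma weightOp_const (c : ℝ) :
    weightOp (fun _ : ι => c) = ((c * c : ℝ) : ℂ) • (1 : BipartiteOp ι ι) := by
  rw [weightOp, ← Matrix.diagonal_one, ← Matrix.diagonal_smul]
  congr 1
  ext p
  simp

variable [Fintype ι]

lemma mul_flipOp_apply (M : BipartiteOp ι ι) (p q : ι × ι) :
    (M * flipOp ι) p q = M p q.swap := by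
  simp [Matrix.mul_apply, flipOp_apply]

lemma flipOp_mul_apply (M : BipartiteOp ι ι) (p q : ι × ι) :
    (flipOp ι * M) p q = M p.swap q := by
  rw [← conjTranspose_flipOp]
  simp [Matrix.mul_apply, flipOp_apply, apply_ite star]

lemma flipOp_mul_flipOp : flipOp ι * flipOp ι = 1 := by
  ext p q
  simp [mul_flipOp_apply, flipOp_apply, Matrix.one_apply]

lemma flipOp_mul_weightOp (a : ι → ℝ) : flipOp ι * weightOp a = weightOp a * flipOp ι := by
  ext p q
  rw [mul_flipOp_apply, flipOp_mul_apply]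
  simp only [weightOp, Matrix.diagonal_apply]
  by_cases h : p.swap = q
  · subst h; simp [mul_comm]
  · have : p ≠ q.swap := fun h' => h (by simp [h'])
    simp [h, this]

/-- For `a ≥ 0` the flip commutes with the positive operator `weightOp a`, so `weightOp a` is the
absolute value of the partial transpose, with trace `(∑ a i) ^ 2`. -/
lemma partialTranspose_schmidtPure (a : ι → ℝ) :
    partialTranspose ι ι (schmidtPure a) = weightOp a * flipOp ι := by
  ext ⟨i, j⟩ ⟨k, l⟩
  rw [mul_flipOp_apply, partialTranspose_apply]
  simp only [schmidtPure, weightOp, Matrix.of_apply, Matrix.diagonal_apply, Prod.swap,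
    Prod.mk.injEq]
  by_cases h : i = l ∧ k = j
  · rw [if_pos h, if_pos ⟨h.1, h.2.symm⟩, h.2]
  · rw [if_neg h, if_neg fun h' => h ⟨h'.1, h'.2.symm⟩]

lemma posSemidef_schmidtPure (a : ι → ℝ) : (schmidtPure a).PosSemidef := by
  rw [schmidtPure_eq_vecMulVec]
  exact Matrix.posSemidef_vecMulVec_self_star _

lemma schmidtPure_mul_self {a : ι → ℝ} (ha : ∑ i, a i ^ 2 = 1) :
    schmidtPure a * schmidtPure a = schmidtPure a := by
  have h : ∑ i, (a i : ℂ) * (a i : ℂ) = 1 := by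
    have := congrArg (fun x : ℝ => (x : ℂ)) ha
    simpa [pow_two] using this
  rw [schmidtPure_eq_vecMulVec, Matrix.vecMulVec_mul_vecMulVec]
  have : (star fun p : ι × ι => if p.1 = p.2 then (a p.1 : ℂ) else 0) ⬝ᵥ
      (fun p : ι × ι => if p.1 = p.2 then (a p.1 : ℂ) else 0) = 1 := by
    rw [← h]
    simp [dotProduct, Fintype.sum_prod_type, apply_ite star]
  rw [this]
  simp

lemma trace_schmidtPure {a : ι → ℝ} (ha : ∑ i, a i ^ 2 = 1) : (schmidtPure a).trace = 1 := by
  have := congrArg (fun x : ℝ => (x : ℂ)) ha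
  simpa [Matrix.trace, schmidtPure, Fintype.sum_prod_type, pow_two] using this

lemma posSemidef_one_sub_schmidtPure {a : ι → ℝ} (ha : ∑ i, a i ^ 2 = 1) :
    (1 - schmidtPure a).PosSemidef := by
  have h : (1 - schmidtPure a) = (1 - schmidtPure a).conjTranspose * (1 - schmidtPure a) := by
    rw [Matrix.conjTranspose_sub, (posSemidef_schmidtPure a).isHermitian.eq,
      Matrix.conjTranspose_one, sub_mul, mul_sub, mul_sub, schmidtPure_mul_self ha]
    simp
  rw [h]
  exact Matrix.posSemidef_conjTranspose_mul_self _

omit [Fintype ι] in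
lemma posSemidef_weightOp {a : ι → ℝ} (ha : ∀ i, 0 ≤ a i) : (weightOp a).PosSemidef :=
  Matrix.PosSemidef.diagonal fun p => by
    exact Complex.zero_le_real.mpr (mul_nonneg (ha p.1) (ha p.2))

lemma trace_weightOp (a : ι → ℝ) : (weightOp a).trace = (((∑ i, a i) ^ 2 : ℝ) : ℂ) := by
  simp [weightOp, Fintype.sum_prod_type, pow_two, Finset.sum_mul_sum]

lemma posSemidef_weightOp_add_flip {a : ι → ℝ} (ha : ∀ i, 0 ≤ a i) {s : ℝ} (hs : s * s = 1) :
    (weightOp a + (s : ℂ) • (weightOp a * flipOp ι)).PosSemidef := by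
  have hs' : (s : ℂ) * s = 1 := by exact_mod_cast hs
  -- The flip `F` commutes with `W = weightOp a` and squares to `1`, so `(1 + sF) W (1 + sF) = 2 (W
  -- + s W F)`.
  have h : weightOp a + (s : ℂ) • (weightOp a * flipOp ι) = ((1 / 2 : ℝ) : ℂ) •
      ((1 + (s : ℂ) • flipOp ι).conjTranspose * weightOp a * (1 + (s : ℂ) • flipOp ι)) := by
    have h1 : (1 + (s : ℂ) • flipOp ι).conjTranspose = 1 + (s : ℂ) • flipOp ι := by
      simp [conjTranspose_flipOp]
    rw [h1]
    simp only [add_mul, mul_add, one_mul, mul_one, Matrix.smul_mul, Matrix.mul_smul,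
      flipOp_mul_weightOp, Matrix.mul_assoc, flipOp_mul_flipOp, smul_smul, hs', one_smul,
      smul_add]
    push_cast
    module
  rw [h]
  exact ((posSemidef_weightOp ha).conjTranspose_mul_mul_same _).smul
    (Complex.zero_le_real.mpr (by norm_num))

lemma posSemidef_one_add_flip {s : ℝ} (hs : s * s = 1) :
    (1 + (s : ℂ) • flipOp ι).PosSemidef := by
  have h : weightOp (fun _ : ι => (1 : ℝ)) = 1 := by
    simp [weightOp]
  simpa [h] using posSemidef_weightOp_add_flip (a := fun _ : ι => (1 : ℝ)) (by simp) hs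

lemma posSemidef_smul_weightOp_add_flip {a : ι → ℝ} (ha : ∀ i, 0 ≤ a i) {c e : ℝ}
    (h₁ : e ≤ c) (h₂ : -e ≤ c) :
    ((c : ℂ) • weightOp a + (e : ℂ) • (weightOp a * flipOp ι)).PosSemidef := by
  have h : (c : ℂ) • weightOp a + (e : ℂ) • (weightOp a * flipOp ι) =
      (((c + e) / 2 : ℝ) : ℂ) • (weightOp a + ((1 : ℝ) : ℂ) • (weightOp a * flipOp ι)) +
      (((c - e) / 2 : ℝ) : ℂ) • (weightOp a + ((-1 : ℝ) : ℂ) • (weightOp a * flipOp ι)) := by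
    push_cast
    module
  rw [h]
  refine ((posSemidef_weightOp_add_flip ha (by norm_num)).smul ?_).add
    ((posSemidef_weightOp_add_flip ha (by norm_num)).smul ?_)
  · exact Complex.zero_le_real.mpr (by linarith)
  · exact Complex.zero_le_real.mpr (by linarith)

lemma partialTranspose_schmidtPure_const {N : ℝ} (hpos : 0 < N) :
    partialTranspose ι ι (schmidtPure fun _ => 1 / √N) = ((1 / N : ℝ) : ℂ) • flipOp ι := by
  rw [partialTranspose_schmidtPure, weightOp_const, Matrix.smul_mul, one_mul]
  congr 2
  rw [div_mul_div_comm, Real.mul_self_sqrt hpos.le, one_mul]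

/-! ### Conversion of a maximally entangled state: sufficiency. -/

/-- A maximally entangled state of rank `N` can be transformed by a PPT operation into any pure
state whose negativity `(∑ i, a i) ^ 2` is at most `N - 1`. -/
theorem pptTransforms_of_sq_sum_le [Fintype κ] [DecidableEq κ] {N : ℝ}
    (hN : (Fintype.card ι : ℝ) = N) (hpos : 0 < N) {a : κ → ℝ} (ha : ∀ i, 0 ≤ a i)
    (hsum : ∑ i, a i ^ 2 = 1) (hT : (∑ i, a i) ^ 2 ≤ N - 1) :
    PPTTransforms (schmidtPure fun _ : ι => 1 / √N) (schmidtPure a) := by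
  set T : ℝ := (∑ i, a i) ^ 2 with hTdef
  have hT1 : 0 < T := by
    refine lt_of_lt_of_le zero_lt_one ?_
    rw [← hsum]
    exact Finset.sum_sq_le_sq_sum_of_nonneg fun i _ => ha i
  have hu := sum_const_sq hN hpos
  set Φ := schmidtPure fun _ : ι => 1 / √N with hΦ
  -- The state prepared when the test `Φ` fails is the normalised absolute value of the target's
  -- partial transpose, so that it can dominate the negative part of that transpose.
  set σ := ((1 / T : ℝ) : ℂ) • weightOp a with hσ
  have hσtr : σ.trace = 1 := by
    rw [hσ, Matrix.trace_smul, trace_weightOp, smul_eq_mul, ← Complex.ofReal_mul, ← hTdef,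
      one_div_mul_cancel hT1.ne', Complex.ofReal_one]
  refine ⟨measurePrepare Φ (schmidtPure a) + measurePrepare (1 - Φ) σ, ⟨?_, ?_, ?_⟩, ?_⟩
  · refine (isCompletelyPositive_measurePrepare (posSemidef_schmidtPure _)
      (posSemidef_schmidtPure _)).add (isCompletelyPositive_measurePrepare
        (posSemidef_one_sub_schmidtPure hu) ((posSemidef_weightOp ha).smul ?_))
    exact Complex.zero_le_real.mpr (by positivity)
  · intro X
    simp only [LinearMap.add_apply, measurePrepare_apply, Matrix.trace_add, Matrix.trace_smul,
      trace_schmidtPure hsum, hσtr, sub_mul, one_mul, Matrix.trace_sub, smul_eq_mul, mul_one]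
    ring
  -- The partial transpose of `Φ` is the flip over `N`; expanding in the positive effects `1 ± F`
  -- leaves two prepared operators whose positivity is to be checked.
  · have key : partialTranspose κ κ ∘ₗ
        (measurePrepare Φ (schmidtPure a) + measurePrepare (1 - Φ) σ) ∘ₗ partialTranspose ι ι =
        measurePrepare (1 + ((1 : ℝ) : ℂ) • flipOp ι)
          ((((1 - 1 / N) / (2 * T) : ℝ) : ℂ) • weightOp a +
            ((1 / (2 * N) : ℝ) : ℂ) • (weightOp a * flipOp κ)) +
        measurePrepare (1 + ((-1 : ℝ) : ℂ) • flipOp ι)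
          ((((1 + 1 / N) / (2 * T) : ℝ) : ℂ) • weightOp a +
            ((-(1 / (2 * N)) : ℝ) : ℂ) • (weightOp a * flipOp κ)) := by
      rw [LinearMap.add_comp, LinearMap.comp_add, partialTranspose_comp_measurePrepare,
        partialTranspose_comp_measurePrepare, map_sub, partialTranspose_one, hσ, map_smul,
        partialTranspose_weightOp, hΦ,
        partialTranspose_schmidtPure_const hpos, partialTranspose_schmidtPure]
      ext1 X
      simp only [LinearMap.add_apply, measurePrepare_apply, sub_mul, add_mul, one_mul,
        Matrix.trace_sub, Matrix.trace_add, Matrix.smul_mul, Matrix.trace_smul, smul_eq_mul]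
      have hNc : (N : ℂ) ≠ 0 := by exact_mod_cast hpos.ne'
      have hTc : (T : ℂ) ≠ 0 := by exact_mod_cast hT1.ne'
      push_cast
      ext p q
      simp only [Matrix.add_apply, Matrix.smul_apply, smul_eq_mul]
      field_simp
      ring
    rw [key]
    -- This inequality is exactly `T ≤ N - 1`.
    have h1 : (1 : ℝ) / (2 * N) ≤ (1 - 1 / N) / (2 * T) := by
      rw [div_le_div_iff₀ (by positivity) (by positivity)]
      have : (1 - 1 / N) * (2 * N) = 2 * (N - 1) := by field_simp
      rw [this]; linarith
    have h2 : (1 - 1 / N) / (2 * T) ≤ (1 + 1 / N) / (2 * T) := by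
      have : 0 < 1 / N := by positivity
      gcongr ?_ / _
      linarith
    have h3 : 0 < 1 / (2 * N) := by positivity
    exact (isCompletelyPositive_measurePrepare (posSemidef_one_add_flip (by norm_num))
      (posSemidef_smul_weightOp_add_flip ha h1 (by linarith))).add
      (isCompletelyPositive_measurePrepare (posSemidef_one_add_flip (by norm_num))
      (posSemidef_smul_weightOp_add_flip ha (by linarith) (by linarith)))
  · rw [LinearMap.add_apply, measurePrepare_apply, measurePrepare_apply, sub_mul, one_mul,
      schmidtPure_mul_self hu, trace_schmidtPure hu, sub_self, Matrix.trace_zero, zero_smul,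
      one_smul, add_zero]

/-! ### Conversion of a maximally entangled state: necessity. -/

omit [DecidableEq ι] in
lemma re_quadratic_nonneg {M : Matrix ι ι ℂ} (hM : M.PosSemidef) (v : ι → ℝ) :
    0 ≤ ∑ i, ∑ j, v i * v j * (M i j).re := by
  have h := (Complex.nonneg_iff.mp (hM.dotProduct_mulVec_nonneg fun i => (v i : ℂ))).1
  simp only [dotProduct, Matrix.mulVec, Pi.star_apply, RCLike.star_def, Complex.conj_ofReal,
    Complex.re_sum, Complex.re_ofReal_mul, Complex.re_mul_ofReal, Finset.mul_sum] at h
  exact h.trans_eq (Finset.sum_congr rfl fun i _ => Finset.sum_congr rfl fun j _ => by ring)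

omit [Fintype ι] [DecidableEq ι] in
lemma re_pair_nonneg {M : Matrix ι ι ℂ} (hM : M.PosSemidef) (p q : ι) {s : ℝ} (hs : s * s = 1) :
    0 ≤ (M p p).re + (M q q).re + s * ((M p q).re + (M q p).re) := by
  have h := re_quadratic_nonneg (hM.submatrix ![p, q]) ![1, s]
  simp [Fin.sum_univ_two, hs] at h
  linarith

/-- The necessary conditions on a pure state obtained from a maximally entangled state of rank
`N` by a PPT operation: its negativity is at most `N`, and if equality holds then so is its
Schmidt rank. -/
theorem sq_sum_le_of_pptTransforms [Fintype κ] [DecidableEq κ] {N : ℝ}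
    (hN : (Fintype.card ι : ℝ) = N) (hpos : 0 < N) {a : κ → ℝ} (ha : ∀ i, 0 ≤ a i)
    (hsum : ∑ i, a i ^ 2 = 1)
    (h : PPTTransforms (schmidtPure fun _ : ι => 1 / √N) (schmidtPure a)) :
    (∑ i, a i) ^ 2 ≤ N ∧
      ((∑ i, a i) ^ 2 = N → ((Finset.univ.filter fun i => a i ≠ 0).card : ℝ) ≤ N) := by
  obtain ⟨L, hL, hLΦ⟩ := h
  have hu := sum_const_sq hN hpos
  have hNc : (N : ℂ) ≠ 0 := by exact_mod_cast hpos.ne'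
  set Φ := schmidtPure fun _ : ι => 1 / √N with hΦ
  set ω := L (1 - Φ) with hω
  have hpsd : ω.PosSemidef :=
    hL.completelyPositive.posSemidef_map (posSemidef_one_sub_schmidtPure hu)
  have htr : ω.trace = ((N ^ 2 - 1 : ℝ) : ℂ) := by
    rw [hω, hL.tracePreserving, Matrix.trace_sub, trace_schmidtPure hu, Matrix.trace_one,
      Fintype.card_prod, ← hN]
    push_cast
    ring
  -- `Γ ∘ L ∘ Γ` is applied to `1 + sF ≥ 0`; since `Γ(F) = N Φ`, the input of `L` is `(1 - Φ) + (1 +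
  -- sN) Φ`, and `L Φ` is known.
  have hpos' : ∀ s : ℝ, s * s = 1 →
      (partialTranspose κ κ ω +
        ((1 + s * N : ℝ) : ℂ) • (weightOp a * flipOp κ)).PosSemidef := by
    intro s hs
    have h1 := hL.completelyPositive_partialTranspose.posSemidef_map
      (posSemidef_one_add_flip (ι := ι) hs)
    have hF : partialTranspose ι ι (1 + (s : ℂ) • flipOp ι) =
        (1 - Φ) + ((1 + s * N : ℝ) : ℂ) • Φ := by
      have : partialTranspose ι ι (flipOp ι) = (N : ℂ) • Φ := by
        rw [← partialTranspose_partialTranspose Φ, hΦ, partialTranspose_schmidtPure_const hpos,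
          map_smul, smul_smul]
        push_cast
        rw [mul_one_div_cancel hNc, one_smul]
      rw [map_add, map_smul, this, partialTranspose_one]
      push_cast
      module
    rw [LinearMap.comp_apply, LinearMap.comp_apply, hF, map_add, map_smul, hLΦ, map_add,
      map_smul, partialTranspose_schmidtPure] at h1
    exact h1
  let α : κ → κ → ℝ := fun i j => (ω (i, j) (i, j)).re
  let β : κ → κ → ℝ := fun i j => (ω (i, i) (j, j)).re
  have hαsum : ∑ i, ∑ j, α i j = N ^ 2 - 1 := by
    have := congrArg Complex.re htr
    rw [Complex.ofReal_re] at this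
    rw [← this]
    simp [Matrix.trace, Fintype.sum_prod_type, α]
  have entry : ∀ (c : ℝ) (p q : κ × κ),
      ((partialTranspose κ κ ω + (c : ℂ) • (weightOp a * flipOp κ)) p q).re =
        (ω (p.1, q.2) (q.1, p.2)).re + if p = q.swap then c * (a p.1 * a p.2) else 0 := by
    intro c p q
    rw [Matrix.add_apply, Matrix.smul_apply, mul_flipOp_apply, partialTranspose_apply, weightOp,
      Matrix.diagonal_apply]
    split_ifs <;> simp
  -- The test vectors `|ij⟩ ∓ |ji⟩` for `s = ±1` make the `β` terms cancel when the two bounds are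
  -- added.
  have hplus : ∀ i j, i ≠ j →
      0 ≤ α i j + α j i - (β i j + β j i) - 2 * (1 + N) * (a i * a j) := by
    intro i j hij
    have := re_pair_nonneg (hpos' 1 (by norm_num)) (i, j) (j, i) (s := -1) (by norm_num)
    simp only [entry] at this
    simp [hij, hij.symm] at this
    simp only [α, β]
    linarith [mul_comm (a i) (a j)]
  have hminus : ∀ i j, i ≠ j →
      0 ≤ α i j + α j i + (β i j + β j i) - 2 * (N - 1) * (a i * a j) := by
    intro i j hij
    have := re_pair_nonneg (hpos' (-1) (by norm_num)) (i, j) (j, i) (s := 1) (by norm_num)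
    simp only [entry] at this
    simp [hij, hij.symm] at this
    simp only [α, β]
    linarith [mul_comm (a i) (a j)]
  have hdiag : ∀ i, 0 ≤ α i i - (N - 1) * (a i * a i) := by
    intro i
    have := re_pair_nonneg (hpos' (-1) (by norm_num)) (i, i) (i, i) (s := 1) (by norm_num)
    simp only [entry] at this
    simp at this
    simp only [α]
    linarith
  -- Lower bound for the symmetrised diagonal of `ω`. The diagonal test gives only `N - 1`, so the
  -- total is `N (∑ a i) ^ 2 - 1`, against the trace `N ^ 2 - 1`; the two `-1`s cancel.
  let w : κ → κ → ℝ := fun i j => N * (a i * a j) - if i = j then a i * a i else 0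
  have hle : ∀ i j, w i j ≤ (α i j + α j i) / 2 := by
    intro i j
    by_cases hij : i = j
    · subst hij
      have := hdiag i
      simp only [w, if_true]
      linarith
    · have h1 := hplus i j hij
      have h2 := hminus i j hij
      simp only [w, if_neg hij]
      linarith
  have hαsym : ∑ i, ∑ j, (α i j + α j i) / 2 = N ^ 2 - 1 := by
    have hc : ∑ i, ∑ j, α j i = ∑ i, ∑ j, α i j := Finset.sum_comm
    simp only [← Finset.sum_div, Finset.sum_add_distrib]
    rw [hc, hαsum]
    ring
  have hwsum : ∑ i, ∑ j, w i j = N * (∑ i, a i) ^ 2 - 1 := by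
    simp only [w, Finset.sum_sub_distrib, Finset.sum_ite_eq, Finset.mem_univ, if_true,
      ← Finset.mul_sum, ← Finset.sum_mul, pow_two]
    simp only [pow_two] at hsum
    rw [hsum]
  have hmain : ∑ i, ∑ j, w i j ≤ ∑ i, ∑ j, (α i j + α j i) / 2 :=
    Finset.sum_le_sum fun i _ => Finset.sum_le_sum fun j _ => hle i j
  refine ⟨?_, fun hT => ?_⟩
  · rw [hwsum, hαsym] at hmain
    exact le_of_mul_le_mul_left (by linarith) hpos
  · have heq : ∀ i j, w i j = (α i j + α j i) / 2 := by
      have htot : ∑ i, ∑ j, w i j = ∑ i, ∑ j, (α i j + α j i) / 2 := by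
        rw [hwsum, hαsym, hT]; ring
      have h1 := (Finset.sum_eq_sum_iff_of_le fun i _ =>
        Finset.sum_le_sum fun j _ => hle i j).mp htot
      exact fun i j => (Finset.sum_eq_sum_iff_of_le fun j _ => hle i j).mp
        (h1 i (Finset.mem_univ i)) j (Finset.mem_univ j)
    -- When every bound on `α` is tight, `hplus` bounds the symmetrised `β` entrywise by `N diag(a²)
    -- - a aᵀ`.
    have hβ : ∀ i j, (β i j + β j i) / 2 ≤
        N * (if i = j then a i * a i else 0) - a i * a j := by
      intro i j
      have h0 := heq i j
      by_cases hij : i = j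
      · subst hij
        simp only [w, if_true] at h0 ⊢
        have : β i i = α i i := rfl
        linarith
      · have h1 := hplus i j hij
        simp only [w, if_neg hij] at h0 ⊢
        linarith
    -- As `0⁻¹ = 0`, this vector inverts `a` on its support and vanishes elsewhere. Testing the
    -- positive matrix `β` on it gives `0 ≤ N r - r ^ 2` for the Schmidt rank `r`.
    let v : κ → ℝ := fun i => (a i)⁻¹
    have hv : ∀ i, 0 ≤ v i := fun i => inv_nonneg.mpr (ha i)
    have hva : ∀ i, v i * a i = if a i ≠ 0 then 1 else 0 := by
      intro i
      by_cases h0 : a i = 0 <;> simp [v, h0]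
    set r : ℝ := ((Finset.univ.filter fun i => a i ≠ 0).card : ℝ) with hr
    have hrsum : ∑ i, v i * a i = r := by
      simp only [hva, hr, Finset.sum_boole]
    have hrsum' : ∑ i, v i * a i * (v i * a i) = r := by
      rw [← hrsum]
      refine Finset.sum_congr rfl fun i _ => ?_
      rw [hva]
      split_ifs <;> simp
    have hq := re_quadratic_nonneg (hpsd.submatrix fun i : κ => (i, i)) v
    have hq' : 0 ≤ ∑ i, ∑ j, v i * v j * β i j := hq
    have hsymm : ∑ i, ∑ j, v i * v j * β i j = ∑ i, ∑ j, v i * v j * ((β i j + β j i) / 2) := by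
      have hc : ∑ i, ∑ j, v i * v j * β j i = ∑ i, ∑ j, v i * v j * β i j := by
        rw [Finset.sum_comm]
        exact Finset.sum_congr rfl fun i _ => Finset.sum_congr rfl fun j _ => by ring
      simp only [mul_div_assoc', mul_add, ← Finset.sum_div, Finset.sum_add_distrib]
      rw [hc]
      ring
    have hbound : ∑ i, ∑ j, v i * v j * ((β i j + β j i) / 2) ≤ N * r - r * r := by
      calc _ ≤ ∑ i, ∑ j, v i * v j * (N * (if i = j then a i * a i else 0) - a i * a j) :=
            Finset.sum_le_sum fun i _ => Finset.sum_le_sum fun j _ =>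
              mul_le_mul_of_nonneg_left (hβ i j) (mul_nonneg (hv i) (hv j))
        _ = N * (∑ i, v i * a i * (v i * a i)) - (∑ i, v i * a i) * ∑ j, v j * a j := by
            rw [Finset.sum_mul_sum, Finset.mul_sum, ← Finset.sum_sub_distrib]
            refine Finset.sum_congr rfl fun i _ => ?_
            simp only [mul_sub, Finset.sum_sub_distrib, mul_ite, mul_zero, Finset.sum_ite_eq,
              Finset.mem_univ, if_true]
            congr 1
            · ring
            · exact Finset.sum_congr rfl fun j _ => by ring
        _ = _ := by rw [hrsum, hrsum']
    have hr0 : 0 ≤ r := Nat.cast_nonneg _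
    by_contra hlt
    push Not at hlt
    have : 0 < r := hpos.trans hlt
    nlinarith

omit [DecidableEq ι] in
/-- Equality in the Cauchy-Schwarz inequality on the support of `a`. -/
lemma eq_zero_or_eq_of_sq_sum_eq {N : ℝ} (hpos : 0 < N) {a : ι → ℝ} (ha : ∀ i, 0 ≤ a i)
    (hsum : ∑ i, a i ^ 2 = 1) (hT : (∑ i, a i) ^ 2 = N)
    (hr : ((Finset.univ.filter fun i => a i ≠ 0).card : ℝ) ≤ N) (i : ι) :
    a i = 0 ∨ a i = 1 / √N := by
  have hsq : ∑ i, a i = √N := by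
    rw [← hT, Real.sqrt_sq (Finset.sum_nonneg fun i _ => ha i)]
  have hs : 0 < √N := Real.sqrt_pos.mpr hpos
  have hss : √N * √N = N := Real.mul_self_sqrt hpos.le
  by_contra! hi
  have hmem : i ∈ Finset.univ.filter fun i => a i ≠ 0 := by simp [hi.1]
  have h1 : (a i - 1 / √N) ^ 2 ≤
      ∑ j ∈ Finset.univ.filter (fun i => a i ≠ 0), (a j - 1 / √N) ^ 2 :=
    Finset.single_le_sum (f := fun j => (a j - 1 / √N) ^ 2) (fun j _ => sq_nonneg _) hmem
  -- The squared distance to the uniform amplitude over the support is `r / N - 1 ≤ 0`, so no term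
  -- can be positive.
  have h2 : ∑ j ∈ Finset.univ.filter (fun i => a i ≠ 0), (a j - 1 / √N) ^ 2 =
      1 - 2 + ((Finset.univ.filter fun i => a i ≠ 0).card : ℝ) / N := by
    have e1 : ∑ j ∈ Finset.univ.filter (fun i => a i ≠ 0), a j ^ 2 = 1 := by
      rw [← hsum, Finset.sum_filter_of_ne]
      intro j _ hj h0
      simp [h0] at hj
    have e2 : ∑ j ∈ Finset.univ.filter (fun i => a i ≠ 0), a j = √N := by
      rw [← hsq, Finset.sum_filter_of_ne]
      exact fun j _ hj => hj
    have e3 : ∀ x : ℝ, (x - 1 / √N) ^ 2 = x ^ 2 - 2 / √N * x + 1 / N := by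
      intro x
      rw [sub_sq, div_pow, one_pow, Real.sq_sqrt hpos.le]
      ring
    simp only [e3]
    rw [Finset.sum_add_distrib, Finset.sum_sub_distrib, ← Finset.mul_sum, e1, e2,
      Finset.sum_const, nsmul_eq_mul, mul_one_div, div_mul_cancel₀ _ hs.ne']
  have h3 : ((Finset.univ.filter fun i => a i ≠ 0).card : ℝ) / N ≤ 1 :=
    (div_le_one hpos).mpr hr
  have h4 : 0 < (a i - 1 / √N) ^ 2 := sq_pos_of_ne_zero (sub_ne_zero.mpr hi.2)
  linarith

end General

/-! ### Application to the catalyst. -/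

section Catalysis

variable {d : ℕ}

lemma schmidtState_eq_schmidtPure {lam : Fin d → ℝ} (h : ∀ i, 0 ≤ lam i) :
    schmidtState lam = schmidtPure fun i => √(lam i) := by
  ext p q
  simp only [schmidtState, schmidtPure, Matrix.of_apply, Real.sqrt_mul (h _)]

/-- With amplitudes over arbitrary index types, tensoring is pointwise multiplication on the product
type, so the conversion theorems apply without reindexing. -/
lemma bipartiteTensor_schmidtPure {ι κ : Type*} [DecidableEq ι] [DecidableEq κ]
    (a : ι → ℝ) (b : κ → ℝ) :
    bipartiteTensor (schmidtPure a) (schmidtPure b) =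
      schmidtPure fun p : ι × κ => a p.1 * b p.2 := by
  ext ⟨⟨i, j⟩, k, l⟩ ⟨⟨i', j'⟩, k', l'⟩
  simp only [bipartiteTensor, schmidtPure, Matrix.submatrix_apply, Equiv.prodProdProdComm_apply,
    Matrix.kroneckerMap_apply, Matrix.of_apply, Prod.mk.injEq]
  by_cases h1 : i = k ∧ i' = k'
  · by_cases h2 : j = l ∧ j' = l'
    · rw [if_pos h1, if_pos h2, if_pos ⟨⟨h1.1, h2.1⟩, h1.2, h2.2⟩]
      push_cast
      ring
    · have h3 : ¬((i = k ∧ j = l) ∧ i' = k' ∧ j' = l') := fun h => h2 ⟨h.1.2, h.2.2⟩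
      rw [if_neg h2, if_neg h3, mul_zero]
  · have h3 : ¬((i = k ∧ j = l) ∧ i' = k' ∧ j' = l') := fun h => h1 ⟨h.1.1, h.2.1⟩
    rw [if_neg h1, if_neg h3, zero_mul]

lemma maxEntangled_eq_schmidtPure (C : ℕ) :
    maxEntangled C = schmidtPure fun _ : Fin C => 1 / √(C : ℝ) := by
  rw [maxEntangled, schmidtState_eq_schmidtPure fun _ => by unfold uniformVec; positivity]
  simp [uniformVec]

lemma maxEntangled_tensor_maxEntangled (C K : ℕ) :
    bipartiteTensor (maxEntangled C) (maxEntangled K) =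
      schmidtPure fun _ : Fin C × Fin K => 1 / √((C : ℝ) * K) := by
  rw [maxEntangled_eq_schmidtPure, maxEntangled_eq_schmidtPure, bipartiteTensor_schmidtPure]
  congr 1
  ext p
  rw [Real.sqrt_mul (Nat.cast_nonneg C), div_mul_div_comm, one_mul]

lemma maxEntangled_tensor_schmidtState (C : ℕ) {lam : Fin d → ℝ} (h : ∀ i, 0 ≤ lam i) :
    bipartiteTensor (maxEntangled C) (schmidtState lam) =
      schmidtPure fun p : Fin C × Fin d => 1 / √(C : ℝ) * √(lam p.2) := by
  rw [maxEntangled_eq_schmidtPure, schmidtState_eq_schmidtPure h, bipartiteTensor_schmidtPure]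

lemma sum_catalyst_sq {C : ℕ} (hC : 0 < C) {lam : Fin d → ℝ} (h : ∀ i, 0 ≤ lam i)
    (hsum : ∑ i, lam i = 1) :
    ∑ p : Fin C × Fin d, (1 / √(C : ℝ) * √(lam p.2)) ^ 2 = 1 := by
  have hC' : (C : ℝ) ≠ 0 := by exact_mod_cast hC.ne'
  simp only [mul_pow, div_pow, Real.sq_sqrt (Nat.cast_nonneg C), Real.sq_sqrt (h _),
    Fintype.sum_prod_type, ← Finset.mul_sum, hsum]
  simp [hC']

lemma sq_sum_catalyst {C : ℕ} (hC : 0 < C) (lam : Fin d → ℝ) :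
    (∑ p : Fin C × Fin d, 1 / √(C : ℝ) * √(lam p.2)) ^ 2 = C * (∑ i, √(lam i)) ^ 2 := by
  have hC' : (C : ℝ) ≠ 0 := by exact_mod_cast hC.ne'
  simp only [Fintype.sum_prod_type, ← Finset.mul_sum, Finset.sum_const, Finset.card_univ,
    Fintype.card_fin, nsmul_eq_mul, mul_pow, div_pow, Real.sq_sqrt (Nat.cast_nonneg C)]
  field_simp

lemma renyiEntropy_half_lt_iff {K : ℕ} (hK : 0 < K) {lam : Fin d → ℝ} (h : ∀ i, 0 ≤ lam i)
    (hsum : ∑ i, lam i = 1) :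
    renyiEntropy (1 / 2) lam < Real.logb 2 (K : ℝ) ↔ (∑ i, √(lam i)) ^ 2 < K := by
  have hpos : 0 < ∑ i, √(lam i) := by
    refine lt_of_le_of_ne (Finset.sum_nonneg fun i _ => Real.sqrt_nonneg _) fun h0 => ?_
    have h1 := (Finset.sum_eq_zero_iff_of_nonneg fun i _ => Real.sqrt_nonneg (lam i)).mp h0.symm
    have : ∑ i, lam i = 0 := Finset.sum_eq_zero fun i hi =>
      (Real.sqrt_eq_zero (h i)).mp (h1 i hi)
    linarith
  have he : renyiEntropy (1 / 2) lam = Real.logb 2 ((∑ i, √(lam i)) ^ 2) := by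
    simp only [renyiEntropy, ← Real.sqrt_eq_rpow, Real.logb_pow]
    norm_num
  rw [he, Real.logb_lt_logb_iff (by norm_num) (by positivity) (by exact_mod_cast hK)]

lemma schmidtCoeffs_eq_replicate {K : ℕ} (hK : 0 < K) {lam : Fin d → ℝ}
    (hsum : ∑ i, lam i = 1) (h : ∀ i, lam i = 0 ∨ lam i = 1 / (K : ℝ)) :
    schmidtCoeffs lam = Multiset.replicate K (1 / (K : ℝ)) := by
  have hK' : (K : ℝ) ≠ 0 := by exact_mod_cast hK.ne'
  have hrep : schmidtCoeffs lam =
      Multiset.replicate (schmidtCoeffs lam).card (1 / (K : ℝ)) := by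
    refine Multiset.eq_replicate.mpr ⟨rfl, fun x hx => ?_⟩
    obtain ⟨hx, hx0⟩ := Multiset.mem_filter.mp hx
    obtain ⟨i, -, rfl⟩ := Multiset.mem_map.mp hx
    exact (h i).resolve_left hx0
  have hs : (schmidtCoeffs lam).sum = 1 := by
    rw [← hsum, schmidtCoeffs, Finset.sum]
    generalize Finset.univ.val.map lam = s
    induction s using Multiset.induction_on with
    | empty => simp
    | cons x s ih =>
      by_cases hx : x = 0
      · rw [Multiset.filter_cons_of_neg (p := fun x : ℝ => x ≠ 0) _ (not_not.mpr hx), ih, hx,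
          Multiset.sum_cons, zero_add]
      · rw [Multiset.filter_cons_of_pos (p := fun x : ℝ => x ≠ 0) _ hx, Multiset.sum_cons,
          Multiset.sum_cons, ih]
  rw [hrep, Multiset.sum_replicate, nsmul_eq_mul, mul_one_div, div_eq_one_iff_eq hK'] at hs
  rw [hrep, Nat.cast_injective hs]

theorem sq_sum_sqrt_lt_of_pptTransforms {K C : ℕ} (hK : 0 < K) (hC : 0 < C) {lam : Fin d → ℝ}
    (hnonneg : ∀ i, 0 ≤ lam i) (hsum : ∑ i, lam i = 1)
    (hne : schmidtCoeffs lam ≠ schmidtCoeffs (uniformVec K))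
    (h : PPTTransforms (bipartiteTensor (maxEntangled C) (maxEntangled K))
      (bipartiteTensor (maxEntangled C) (schmidtState lam))) :
    (∑ i, √(lam i)) ^ 2 < K := by
  have hC' : (0 : ℝ) < C := by exact_mod_cast hC
  have hK' : (0 : ℝ) < K := by exact_mod_cast hK
  rw [maxEntangled_tensor_maxEntangled, maxEntangled_tensor_schmidtState C hnonneg] at h
  have hnn : ∀ p : Fin C × Fin d, 0 ≤ 1 / √(C : ℝ) * √(lam p.2) := fun p => by positivity
  have hs := sum_catalyst_sq hC hnonneg hsum
  obtain ⟨hle, hrank⟩ := sq_sum_le_of_pptTransforms (by simp) (mul_pos hC' hK') hnn hs h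
  rw [sq_sum_catalyst hC] at hle hrank
  refine lt_of_le_of_ne (le_of_mul_le_mul_left hle hC') fun heq => hne ?_
  have hT : (∑ p : Fin C × Fin d, 1 / √(C : ℝ) * √(lam p.2)) ^ 2 = C * K := by
    rw [sq_sum_catalyst hC, heq]
  -- The amplitudes `√(λᵢ / C)` lie in `{0, 1/√(CK)}`, which leaves `λᵢ ∈ {0, 1/K}`.
  have huni := eq_zero_or_eq_of_sq_sum_eq (mul_pos hC' hK') hnn hs hT (hrank (by rw [heq]))
  have hlam : ∀ i, lam i = 0 ∨ lam i = 1 / (K : ℝ) := by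
    intro i
    have hsC : √(C : ℝ) ≠ 0 := (Real.sqrt_pos.mpr hC').ne'
    refine (huni (⟨0, hC⟩, i)).imp (fun h0 => ?_) fun h1 => ?_
    · simpa [hsC, Real.sqrt_eq_zero (hnonneg i)] using h0
    · rw [Real.sqrt_mul hC'.le, one_div_mul_eq_div, ← div_div, div_right_comm] at h1
      have h2 := congrArg (fun x => (x * √(C : ℝ)) ^ 2) h1
      simpa [hsC, Real.sq_sqrt, hnonneg i, div_right_comm] using h2
  rw [schmidtCoeffs_eq_replicate hK hsum hlam,
    schmidtCoeffs_eq_replicate (lam := uniformVec K) hK (by simp [uniformVec, hK.ne'])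
      fun _ => Or.inr rfl]

theorem pptTransforms_of_sq_sum_sqrt_lt {K : ℕ} (hK : 0 < K) {lam : Fin d → ℝ}
    (hnonneg : ∀ i, 0 ≤ lam i) (hsum : ∑ i, lam i = 1) (h : (∑ i, √(lam i)) ^ 2 < K) :
    ∃ C₀ : ℕ, ∀ C : ℕ, C₀ ≤ C →
      PPTTransforms (bipartiteTensor (maxEntangled C) (maxEntangled K))
        (bipartiteTensor (maxEntangled C) (schmidtState lam)) := by
  -- `C ≥ 1/(K - T)` is what `C T ≤ C K - 1` requires; the threshold `n + 1` also keeps `C`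
  -- positive.
  obtain ⟨n, hn⟩ := exists_nat_ge (1 / ((K : ℝ) - (∑ i, √(lam i)) ^ 2))
  have hΔ : 0 < (K : ℝ) - (∑ i, √(lam i)) ^ 2 := sub_pos.mpr h
  refine ⟨n + 1, fun C hC => ?_⟩
  have hC0 : 0 < C := by omega
  have hC' : (0 : ℝ) < C := by exact_mod_cast hC0
  have hK' : (0 : ℝ) < K := by exact_mod_cast hK
  have hnC : (n : ℝ) ≤ C := by exact_mod_cast (by omega : n ≤ C)
  rw [maxEntangled_tensor_maxEntangled, maxEntangled_tensor_schmidtState C hnonneg]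
  refine pptTransforms_of_sq_sum_le (by simp) (mul_pos hC' hK') (fun p => by positivity)
    (sum_catalyst_sq hC0 hnonneg hsum) ?_
  rw [sq_sum_catalyst hC0]
  have := (div_le_iff₀ hΔ).mp (hn.trans hnC)
  linarith

end Catalysis

end PPTCatalysis

theorem theoremt (K d : ℕ) (hK : 2 ≤ K) (lam : Fin d → ℝ)
    (hnonneg : ∀ i, 0 ≤ lam i) (hsum : ∑ i, lam i = 1)
    (hne : PPTCatalysis.schmidtCoeffs lam ≠
      PPTCatalysis.schmidtCoeffs (PPTCatalysis.uniformVec K)) :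
    ((∃ C : ℕ, 2 ≤ C ∧
        PPTCatalysis.PPTTransforms
          (PPTCatalysis.bipartiteTensor (PPTCatalysis.maxEntangled C)
            (PPTCatalysis.maxEntangled K))
          (PPTCatalysis.bipartiteTensor (PPTCatalysis.maxEntangled C)
            (PPTCatalysis.schmidtState lam))) ↔
      PPTCatalysis.renyiEntropy (1 / 2) lam < Real.logb 2 (K : ℝ)) ∧
    (PPTCatalysis.renyiEntropy (1 / 2) lam < Real.logb 2 (K : ℝ) →
      ∃ C₀ : ℕ, ∀ C : ℕ, C₀ ≤ C →
        PPTCatalysis.PPTTransforms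
          (PPTCatalysis.bipartiteTensor (PPTCatalysis.maxEntangled C)
            (PPTCatalysis.maxEntangled K))
          (PPTCatalysis.bipartiteTensor (PPTCatalysis.maxEntangled C)
            (PPTCatalysis.schmidtState lam))) := by
  rw [PPTCatalysis.renyiEntropy_half_lt_iff (by omega) hnonneg hsum]
  have hex := PPTCatalysis.pptTransforms_of_sq_sum_sqrt_lt (K := K) (by omega) hnonneg hsum
  refine ⟨⟨?_, fun h => ?_⟩, hex⟩
  · rintro ⟨C, hC, h⟩
    exact PPTCatalysis.sq_sum_sqrt_lt_of_pptTransforms (by omega) (by omega) hnonneg hsum hne h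
  · obtain ⟨C₀, hC₀⟩ := hex h
    exact ⟨max C₀ 2, le_max_right _ _, hC₀ _ (le_max_left _ _)⟩
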